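/- Let $V$ be a finite totally ordered set (for instance $[m]=\{1,\dots,m\}$) and let $\mathcal K$ be a simplicial complex on $V$ that contains $\varnothing$ and all singletons $\{i\}$, $i\in V$. For $I\subset V$ let $\mathcal K_I=\{\sigma\in\mathcal K:\sigma\subset I\}$ be the full subcomplex on $I$, and let $\widetilde H^*(\mathcal K_I)$ be its reduced simplicial cohomology with coefficients in $\mathbb Z$ (so that $\widetilde H^{-1}(\mathcal K_\varnothing)=\mathbb Z$). By the Hochster decomposition, the cohomology of the moment-angle complex $\mathcal Z_{\mathcal K}$ is $H^*(\mathcal Z_{\mathcal K})=\bigoplus_{I\subset V}\widetilde H^*(\mathcal K_I)$, with bigraded components $$H^{-k,2\ell}(\mathcal Z_{\mathcal K})=\bigoplus_{I\subset V,\ |I|=\ell}\widetilde H^{\ell-k-1}(\mathcal K_I),\qquad k,\ell\in\mathbb Z.$$ Define $d'\colon H^{-k,2\ell}(\mathcal Z_{\mathcal K})\to H^{-k+1,2\ell-2}(\mathcal Z_{\mathcal K})$ on the summand $\widetilde H^p(\mathcal K_I)$ by $$d'=(-1)^{p+1}\sum_{i\in I}\varepsilon(i,I)\,\psi_{p;i,I},\qquad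 \varepsilon(i,I)=(-1)^{\#\{j\in I:\,j<i\}},$$ where $\psi_{p;i,I}\colon\widetilde H^p(\mathcal K_I)\to\widetilde H^p(\mathcal K_{I\setminus\{i\}})$ is induced by the inclusion $\mathcal K_{I\setminus\{i\}}\hookrightarrow\mathcal K_I$. Then $(d')^2=0$, and the bigraded double cohomology of $\mathcal Z_{\mathcal K}$ is $\mathit{HH}^{*}(\mathcal Z_{\mathcal K})=H\bigl(H^*(\mathcal Z_{\mathcal K}),d'\bigr)$, where $\mathit{HH}^{-k,2\ell}(\mathcal Z_{\mathcal K})$ is the cohomology at $H^{-k,2\ell}(\mathcal Z_{\mathcal K})$. **Theorem.** Suppose that $\mathcal K=\mathcal K'\sqcup \mathit{pt}$ is the disjoint union of a nonempty simplicial complex $\mathcal K'$ (one with at least one vertex) and a point. Then, as abelian groups, $$\mathit{HH}^{-k,2\ell}(\mathcal Z_{\mathcal K})\cong\begin{cases}\mathbb Z & \text{for }(-k,2\ell)=(0,0)\text{ and }(-k,2\ell)=(-1,4),\\ 0 & \text{otherwise.}\end{cases}$$ -/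

import Mathlib

namespace DoubleCohomology

/-! ### Simplicial complexes -/

section Complexes

variable {V : Type*}

/-- The full subcomplex `K_I` of `K` on a set `I` of vertices. -/
def fullSubcomplex (K : PreAbstractSimplicialComplex V) (I : Finset V) :
    PreAbstractSimplicialComplex V where
  faces := {s | s ∈ K.faces ∧ s ⊆ I}
  isRelLowerSet_faces := fun _ hs =>
    ⟨(K.isRelLowerSet_faces hs.1).1, fun _ hts ht =>
      ⟨(K.isRelLowerSet_faces hs.1).2 hts ht, hts.trans hs.2⟩⟩

theorem fullSubcomplex_mono (K : PreAbstractSimplicialComplex V) {I J : Finset V} (h : I ⊆ J) :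
    fullSubcomplex K I ≤ fullSubcomplex K J :=
  fun _ hs => ⟨hs.1, hs.2.trans h⟩

/-- The complex `pt` whose only vertex, and only nonempty face, is `v`. -/
def point (v : V) : PreAbstractSimplicialComplex V where
  faces := {{v}}
  isRelLowerSet_faces := by
    rintro _ rfl
    exact ⟨Finset.singleton_nonempty v, fun _ hts ht => ht.subset_singleton_iff.mp hts⟩

/-- `K = K₁ ⊔ K₂` is the disjoint union of `K₁` and `K₂`: its faces are those of `K₁` and those of
`K₂`, and `K₁` and `K₂` have no vertex in common. -/
def IsDisjointUnion (K K₁ K₂ : PreAbstractSimplicialComplex V) : Prop :=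
  K.faces = K₁.faces ∪ K₂.faces ∧ ∀ v : V, {v} ∈ K₁.faces → {v} ∉ K₂.faces

/-- A simplex of `L`, possibly empty: either the empty set or a (nonempty) face. -/
def IsSimplex (L : PreAbstractSimplicialComplex V) (s : Finset V) : Prop :=
  s = ∅ ∨ s ∈ L.faces

theorem IsSimplex.subset {L : PreAbstractSimplicialComplex V} {s t : Finset V}
    (hs : IsSimplex L s) (hts : t ⊆ s) : IsSimplex L t := by
  rcases t.eq_empty_or_nonempty with ht | ht
  · exact Or.inl ht
  · rcases hs with rfl | hs
    · exact Or.inl (Finset.subset_empty.mp hts)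
    · exact Or.inr ((L.isRelLowerSet_faces hs).2 hts ht)

theorem IsSimplex.mono {L M : PreAbstractSimplicialComplex V} (h : L ≤ M) {s : Finset V}
    (hs : IsSimplex L s) : IsSimplex M s :=
  hs.imp id fun hs => h hs

/-- The simplices of dimension `p`, that is, those with `p + 1` elements. The empty simplex is the
only one of dimension `-1`. -/
abbrev Simplex (L : PreAbstractSimplicialComplex V) (p : ℤ) : Type _ :=
  {s : Finset V // IsSimplex L s ∧ (s.card : ℤ) = p + 1}

end Complexes

/-! ### Reduced simplicial cohomology with integer coefficients -/

section Cohomology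

variable {V : Type*} [LinearOrder V]

/-- The sign `ε(j, I) = (-1)^#{i ∈ I | i < j}`. -/
def eps (j : V) (I : Finset V) : ℤ :=
  (-1) ^ (I.filter fun i => i < j).card

/-- The face `s \ {j}` of the simplex `s`. -/
def Simplex.erase {L : PreAbstractSimplicialComplex V} {p q : ℤ} (h : p + 1 = q)
    (s : Simplex L q) (j : V) (hj : j ∈ s.1) : Simplex L p :=
  ⟨s.1.erase j, s.2.1.subset (Finset.erase_subset j s.1), by
    have h₁ := Finset.card_erase_add_one hj
    have h₂ := s.2.2
    omega⟩

/-- The augmented simplicial cochains `C^p(L)` with integer coefficients. -/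
abbrev Cochain (L : PreAbstractSimplicialComplex V) (p : ℤ) : Type _ :=
  Simplex L p → ℤ

/-- The simplicial coboundary `d : C^p(L) → C^q(L)`, where `q = p + 1` and every simplex is
oriented by the order of its vertices: `(d α)(s) = ∑_{j ∈ s} ε(j, s) α(s \ {j})`. -/
def coboundary (L : PreAbstractSimplicialComplex V) (p q : ℤ) (h : p + 1 = q) :
    Cochain L p →ₗ[ℤ] Cochain L q where
  toFun α s := ∑ j ∈ s.1.attach, eps j.1 s.1 * α (s.erase h j.1 j.2)
  map_add' α β := by
    funext s
    simp [mul_add, Finset.sum_add_distrib]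
  map_smul' c α := by
    funext s
    simp [Finset.mul_sum, mul_left_comm]

/-- The `p`-cocycles of `L`. -/
def cocycles (L : PreAbstractSimplicialComplex V) (p : ℤ) : Submodule ℤ (Cochain L p) :=
  LinearMap.ker (coboundary L p (p + 1) rfl)

/-- The `p`-coboundaries of `L`. -/
def coboundaries (L : PreAbstractSimplicialComplex V) (p : ℤ) : Submodule ℤ (Cochain L p) :=
  LinearMap.range (coboundary L (p - 1) p (sub_add_cancel p 1))

/-- The reduced simplicial cohomology group `H̃^p(L)`. -/
def RedCohomology (L : PreAbstractSimplicialComplex V) (p : ℤ) : Type _ :=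
  cocycles L p ⧸ (coboundaries L p).submoduleOf (cocycles L p)

instance (L : PreAbstractSimplicialComplex V) (p : ℤ) : AddCommGroup (RedCohomology L p) :=
  inferInstanceAs
    (AddCommGroup (cocycles L p ⧸ (coboundaries L p).submoduleOf (cocycles L p)))

instance (L : PreAbstractSimplicialComplex V) (p : ℤ) : Module ℤ (RedCohomology L p) :=
  inferInstanceAs
    (Module ℤ (cocycles L p ⧸ (coboundaries L p).submoduleOf (cocycles L p)))

/-- Restriction of cochains along an inclusion `L ≤ M` of simplicial complexes. -/
def restrict {L M : PreAbstractSimplicialComplex V} (h : L ≤ M) (p : ℤ) :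
    Cochain M p →ₗ[ℤ] Cochain L p where
  toFun α s := α ⟨s.1, s.2.1.mono h, s.2.2⟩
  map_add' _ _ := rfl
  map_smul' _ _ := rfl

theorem coboundary_restrict {L M : PreAbstractSimplicialComplex V} (h : L ≤ M) (p q : ℤ)
    (hpq : p + 1 = q) (α : Cochain M p) :
    coboundary L p q hpq (restrict h p α) = restrict h q (coboundary M p q hpq α) :=
  rfl

theorem restrict_mem_cocycles {L M : PreAbstractSimplicialComplex V} (h : L ≤ M) (p : ℤ)
    (α : Cochain M p) (hα : α ∈ cocycles M p) : restrict h p α ∈ cocycles L p := by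
  have hα' : coboundary M p (p + 1) rfl α = 0 := hα
  show coboundary L p (p + 1) rfl (restrict h p α) = 0
  rw [coboundary_restrict, hα', map_zero]

/-- Restriction of cocycles along an inclusion `L ≤ M` of simplicial complexes. -/
def restrictCocycles {L M : PreAbstractSimplicialComplex V} (h : L ≤ M) (p : ℤ) :
    cocycles M p →ₗ[ℤ] cocycles L p :=
  (restrict h p).restrict (restrict_mem_cocycles h p)

theorem submoduleOf_le_comap_restrictCocycles {L M : PreAbstractSimplicialComplex V} (h : L ≤ M)
    (p : ℤ) : (coboundaries M p).submoduleOf (cocycles M p) ≤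
      ((coboundaries L p).submoduleOf (cocycles L p)).comap (restrictCocycles h p) := by
  rintro ⟨α, hα⟩ ⟨β, hβ⟩
  exact ⟨restrict h (p - 1) β, by
    rw [coboundary_restrict, hβ]
    rfl⟩

/-- The homomorphism `H̃^p(M) → H̃^p(L)` induced by an inclusion `L ≤ M`. -/
def RedCohomology.map {L M : PreAbstractSimplicialComplex V} (h : L ≤ M) (p : ℤ) :
    RedCohomology M p →ₗ[ℤ] RedCohomology L p :=
  Submodule.mapQ _ _ (restrictCocycles h p) (submoduleOf_le_comap_restrictCocycles h p)

end Cohomology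

/-! ### Double cohomology of the moment-angle complex -/

section Double

variable {V : Type*} [LinearOrder V] [Fintype V]

/-- The group `⨁_{I ⊆ V} H̃^p(K_I)` of all classes of simplicial degree `p` in the Hochster
decomposition `H^*(Z_K) = ⨁_{I ⊆ V} H̃^*(K_I)`. As `V` is finite, the sum is a product. -/
abbrev HochsterSum (K : PreAbstractSimplicialComplex V) (p : ℤ) : Type _ :=
  ∀ I : Finset V, RedCohomology (fullSubcomplex K I) p

/-- The homomorphism `ψ_{p;i,I} : H̃^p(K_I) → H̃^p(K_{I \ {i}})` induced by the inclusion, for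
`I = J ∪ {i}` with `i ∉ J`, so that `I \ {i} = J`. -/
def psi (K : PreAbstractSimplicialComplex V) (p : ℤ) (i : V) (J : Finset V) :
    RedCohomology (fullSubcomplex K (insert i J)) p →ₗ[ℤ] RedCohomology (fullSubcomplex K J) p :=
  RedCohomology.map (fullSubcomplex_mono K (Finset.subset_insert i J)) p

/-- The differential `d'`, which on `H̃^p(K_I)` is `(-1)^(p+1) ∑_{i ∈ I} ε(i, I) ψ_{p;i,I}`. The
component of `d' x` in `H̃^p(K_J)` collects the contributions of the sets `I = J ∪ {i}`, `i ∉ J`. -/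
def dPrime (K : PreAbstractSimplicialComplex V) (p : ℤ) : HochsterSum K p →ₗ[ℤ] HochsterSum K p :=
  LinearMap.pi fun J => ((p + 1).negOnePow : ℤ) •
    ∑ i ∈ Jᶜ, eps i (insert i J) • psi K p i J ∘ₗ LinearMap.proj (insert i J)

/-- The summand `⨁_{|I| = ℓ} H̃^p(K_I)`. With `p = ℓ - k - 1` this is the bigraded component
`CH^{-k,2ℓ}(Z_K) = H^{-k,2ℓ}(Z_K)`. -/
def CH (K : PreAbstractSimplicialComplex V) (p l : ℤ) : Submodule ℤ (HochsterSum K p) where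
  carrier := {x | ∀ I : Finset V, (I.card : ℤ) ≠ l → x I = 0}
  zero_mem' := fun _ _ => rfl
  add_mem' := fun hx hy I hI => by simp [hx I hI, hy I hI]
  smul_mem' := fun c _ hx I hI => by simp [hx I hI]

/-- The double cocycles: the kernel of `d'` on `⨁_{|I| = ℓ} H̃^p(K_I)`. -/
def doubleCocycles (K : PreAbstractSimplicialComplex V) (p l : ℤ) :
    Submodule ℤ (HochsterSum K p) :=
  CH K p l ⊓ LinearMap.ker (dPrime K p)

/-- The double coboundaries: the image under `d'` of `⨁_{|I| = ℓ + 1} H̃^p(K_I)`. -/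
def doubleCoboundaries (K : PreAbstractSimplicialComplex V) (p l : ℤ) :
    Submodule ℤ (HochsterSum K p) :=
  (CH K p (l + 1)).map (dPrime K p)

/-- The bigraded component `HH^{-k,2ℓ}(Z_K)` of the double cohomology: the cohomology of
`CH^{-k-1,2ℓ+2}(Z_K) → CH^{-k,2ℓ}(Z_K) → CH^{-k+1,2ℓ-2}(Z_K)`, where all three groups have simplicial
degree `p = ℓ - k - 1`. -/
abbrev HH (K : PreAbstractSimplicialComplex V) (k l : ℤ) : Type _ :=
  doubleCocycles K (l - k - 1) l ⧸
    (doubleCoboundaries K (l - k - 1) l).submoduleOf (doubleCocycles K (l - k - 1) l)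

end Double

end DoubleCohomology

/-! The differential `d'` preserves the simplicial degree `p`, so each `p` gives a separate complex.
For `p < -1` it is zero. For `p = -1` only `K_∅` contributes, a copy of ℤ on which `d' = 0`; this is
the class in bidegree (0, 0).

For `p ≥ 0` let `v` be the isolated vertex and split the sets `I` according to whether they contain
`v`. The complex is then, up to signs, the cone of the restrictions `H̃^p(K_I) → H̃^p(K_{I \ {v}})`.
These are surjective for `p ≥ 0` (`map_erase_surjective`) and injective for `p ≥ 1`
(`map_erase_injective`), so there is no cohomology for `p ≥ 1`.

For `p = 0` the kernel is spanned by the class of the indicator of `v`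
(`exists_eq_smul_vertexClass`), which has infinite order if `v ∈ I ≠ {v}` and vanishes otherwise.
What remains is one ℤ for each nonempty subset of `V \ {v}`: the complex of a full simplex with its
empty face removed. Contracting to a vertex `w ≠ v` leaves one generator, `pairClass`, at `I = {v,
w}`, hence in bidegree (-1, 4). The functional `pairSum` kills coboundaries and is nonzero on
`pairClass`, so the class has infinite order. -/

namespace DoubleCohomology

/-! ### Simplices of low dimension and isolated vertices. -/

section Simplices

variable {V : Type*}

/-- The empty simplex. -/
def emptySimplex (L : PreAbstractSimplicialComplex V) {p : ℤ} (hp : p + 1 = 0) : Simplex L p :=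
  ⟨∅, Or.inl rfl, by simp [hp]⟩

theorem eq_emptySimplex {L : PreAbstractSimplicialComplex V} {p : ℤ} (hp : p + 1 = 0)
    (s : Simplex L p) : s = emptySimplex L hp := by
  have h := s.2.2.trans hp
  exact Subtype.ext (Finset.card_eq_zero.mp (by exact_mod_cast h))

theorem Simplex.notMem_of_isolated {K : PreAbstractSimplicialComplex V} {v : V}
    (hv : ∀ s ∈ K.faces, v ∈ s → s = {v})
    {I : Finset V} {q : ℤ}
    (hq : 1 ≤ q) (s : Simplex (fullSubcomplex K I) q) : v ∉ s.1 := by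
  intro h
  have hc := s.2.2
  rcases s.2.1 with h' | h'
  · simp [h'] at h
  · rw [hv _ h'.1 h] at hc
    simp at hc
    omega

end Simplices

/-! ### Cohomology classes and their representatives. -/

section Classes

variable {V : Type*} [LinearOrder V]

/-- The class of a cocycle. -/
def RedCohomology.mk {L : PreAbstractSimplicialComplex V} {p : ℤ} :
    cocycles L p →ₗ[ℤ] RedCohomology L p :=
  Submodule.mkQ _

theorem RedCohomology.mk_surjective {L : PreAbstractSimplicialComplex V} {p : ℤ} :
    Function.Surjective (RedCohomology.mk (L := L) (p := p)) :=
  Submodule.mkQ_surjective _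

theorem RedCohomology.mk_eq_zero_iff {L : PreAbstractSimplicialComplex V} {p : ℤ}
    (α : cocycles L p) : RedCohomology.mk α = 0 ↔
      ∃ β, coboundary L (p - 1) p (sub_add_cancel p 1) β = α.1 :=
  Submodule.Quotient.mk_eq_zero _

theorem RedCohomology.map_mk {L M : PreAbstractSimplicialComplex V} (h : L ≤ M) {p : ℤ}
    (α : cocycles M p) :
    RedCohomology.map h p (RedCohomology.mk α) = RedCohomology.mk (restrictCocycles h p α) :=
  rfl

theorem RedCohomology.map_map {L M N : PreAbstractSimplicialComplex V} (h : L ≤ M) (h' : M ≤ N)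
    {p : ℤ} (x : RedCohomology N p) :
    RedCohomology.map h p (RedCohomology.map h' p x) = RedCohomology.map (h.trans h') p x := by
  obtain ⟨α, rfl⟩ := RedCohomology.mk_surjective x
  rfl

theorem eps_mul_self (j : V) (I : Finset V) : eps j I * eps j I = 1 := by
  rw [eps, ← mul_pow]
  simp

theorem eps_singleton (j : V) : eps j {j} = 1 := by
  simp [eps, Finset.filter_singleton]

/-- A cochain of degree -1 is a single number and its coboundary is the constant function with that
value. The hypothesis `p + 1 = 0` covers both forms `-1` and `0 - 1` of the degree. -/
theorem coboundary_zero_apply {L : PreAbstractSimplicialComplex V} {p q : ℤ} (hp : p + 1 = 0)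
    (h : p + 1 = q) (β : Cochain L p) (s : Simplex L q) :
    coboundary L p q h β s = β (emptySimplex L hp) := by
  obtain ⟨s, hs, hc⟩ := s
  obtain ⟨j, rfl⟩ := Finset.card_eq_one.mp (show s.card = 1 by omega)
  show ∑ i ∈ Finset.attach {j}, _ = _
  rw [Finset.sum_eq_single_of_mem ⟨j, Finset.mem_singleton_self j⟩ (Finset.mem_attach _ _)]
  · rw [eq_emptySimplex hp (Simplex.erase _ _ _ _), eps_singleton, one_mul]
  · rintro ⟨i, hi⟩ _ hne
    exact absurd (Subtype.ext (Finset.mem_singleton.mp hi)) hne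

theorem RedCohomology.subsingleton_of_lt {L : PreAbstractSimplicialComplex V} {p : ℤ}
    (hp : p < -1) : Subsingleton (RedCohomology L p) := by
  have : IsEmpty (Simplex L p) := ⟨fun s => by have := s.2.2; omega⟩
  have : Subsingleton (cocycles L p) :=
    ⟨fun a b => Subtype.ext (funext fun s => isEmptyElim s)⟩
  exact RedCohomology.mk_surjective.subsingleton

end Classes

/-! ### Cohomology of full subcomplexes near an isolated vertex. -/

section Isolated

variable {V : Type*} [LinearOrder V] {K : PreAbstractSimplicialComplex V} {v : V}

/-- Extension by zero of cochains from `K_{I \ {v}}` to `K_I`. -/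
def extend (K : PreAbstractSimplicialComplex V) (v : V) (I : Finset V) (p : ℤ)
    (α : Cochain (fullSubcomplex K (I.erase v)) p) : Cochain (fullSubcomplex K I) p :=
  fun s => if h : v ∈ s.1 then 0 else
    α ⟨s.1, s.2.1.imp id fun hs => ⟨hs.1, Finset.subset_erase.mpr ⟨hs.2, h⟩⟩, s.2.2⟩

theorem extend_of_notMem {I : Finset V} {p : ℤ} (α : Cochain (fullSubcomplex K (I.erase v)) p)
    (s : Simplex (fullSubcomplex K I) p) (h : v ∉ s.1) :
    extend K v I p α s =
      α ⟨s.1, s.2.1.imp id fun hs => ⟨hs.1, Finset.subset_erase.mpr ⟨hs.2, h⟩⟩, s.2.2⟩ :=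
  dif_neg h

theorem restrict_extend {I : Finset V} {p : ℤ} (α : Cochain (fullSubcomplex K (I.erase v)) p) :
    restrict (fullSubcomplex_mono K (I.erase_subset v)) p (extend K v I p α) = α := by
  funext s
  have hs : v ∉ s.1 := by
    rcases s.2.1 with h | h
    · simp [h]
    · exact fun hv => Finset.notMem_erase v I (h.2 hv)
  exact extend_of_notMem α ⟨s.1, s.2.1.mono (fullSubcomplex_mono K (I.erase_subset v)), s.2.2⟩ hs

theorem coboundary_extend_of_notMem {I : Finset V} {p q : ℤ} (hpq : p + 1 = q)
    (α : Cochain (fullSubcomplex K (I.erase v)) p)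
    (s : Simplex (fullSubcomplex K I) q) (h : v ∉ s.1) :
    coboundary _ p q hpq (extend K v I p α) s = coboundary _ p q hpq α
      ⟨s.1, s.2.1.imp id fun hs => ⟨hs.1, Finset.subset_erase.mpr ⟨hs.2, h⟩⟩, s.2.2⟩ := by
  refine Finset.sum_congr rfl fun j _ => ?_
  rw [extend_of_notMem]
  · rfl
  · exact fun hv => h (Finset.mem_of_mem_erase hv)

/-- Extension by zero keeps cocycles closed: their coboundary lives on simplices of dimension at
least 1, which avoid `v`. -/
theorem map_erase_surjective (hv : ∀ s ∈ K.faces, v ∈ s → s = {v}) (I : Finset V) {p : ℤ}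
    (hp : 0 ≤ p) :
    Function.Surjective (RedCohomology.map (fullSubcomplex_mono K (I.erase_subset v)) p) := by
  intro x
  obtain ⟨α, rfl⟩ := RedCohomology.mk_surjective x
  refine ⟨RedCohomology.mk ⟨extend K v I p α.1, ?_⟩, ?_⟩
  · refine LinearMap.mem_ker.mpr (funext fun s => ?_)
    rw [coboundary_extend_of_notMem _ _ _ (s.notMem_of_isolated hv (by omega)),
      LinearMap.mem_ker.mp α.2]
    rfl
  · rw [RedCohomology.map_mk]
    exact congrArg _ (Subtype.ext (restrict_extend α.1))

/-- For `p ≥ 1` the `p`-simplices already avoid `v`, so a primitive over `I \ {v}`, extended by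
zero, is a primitive over `I`. -/
theorem map_erase_injective (hv : ∀ s ∈ K.faces, v ∈ s → s = {v}) (I : Finset V) {p : ℤ}
    (hp : 1 ≤ p) :
    Function.Injective (RedCohomology.map (fullSubcomplex_mono K (I.erase_subset v)) p) := by
  refine (injective_iff_map_eq_zero _).mpr fun x hx => ?_
  obtain ⟨α, rfl⟩ := RedCohomology.mk_surjective x
  rw [RedCohomology.map_mk, RedCohomology.mk_eq_zero_iff] at hx
  obtain ⟨β, hβ⟩ := hx
  refine (RedCohomology.mk_eq_zero_iff _).mpr ⟨extend K v I (p - 1) β, funext fun s => ?_⟩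
  rw [coboundary_extend_of_notMem _ _ _ (s.notMem_of_isolated hv hp), hβ]
  rfl

/-- The class in `H̃^0(K_I)` of the indicator function of the isolated vertex `v`. -/
def vertexClass (hv : ∀ s ∈ K.faces, v ∈ s → s = {v}) (I : Finset V) :
    RedCohomology (fullSubcomplex K I) 0 :=
  RedCohomology.mk ⟨fun s => if s.1 = {v} then 1 else 0, by
    refine LinearMap.mem_ker.mpr (funext fun s => Finset.sum_eq_zero fun j _ => ?_)
    have h : (s.erase rfl j.1 j.2).1 ≠ {v} := fun h =>
      s.notMem_of_isolated hv (by norm_num) (Finset.erase_subset j.1 s.1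
        ((Finset.ext_iff.mp h v).mpr (Finset.mem_singleton_self v)))
    simp [h]⟩

theorem map_vertexClass (hv : ∀ s ∈ K.faces, v ∈ s → s = {v}) {I J : Finset V} (h : J ⊆ I) :
    RedCohomology.map (fullSubcomplex_mono K h) 0 (vertexClass hv I) = vertexClass hv J :=
  rfl

theorem vertexClass_of_notMem (hv : ∀ s ∈ K.faces, v ∈ s → s = {v}) {I : Finset V} (h : v ∉ I) :
    vertexClass hv I = 0 := by
  refine (RedCohomology.mk_eq_zero_iff _).mpr ⟨0, ?_⟩
  rw [map_zero]
  refine funext fun s => (if_neg fun hs => ?_).symm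
  rcases s.2.1 with h' | h'
  · simp [h'] at hs
  · exact h (h'.2 (hs ▸ Finset.mem_singleton_self v))

/-- On a single vertex the indicator is constant, hence a coboundary. This is the missing empty face
that creates the class in bidegree (-1, 4). -/
theorem vertexClass_singleton (hv : ∀ s ∈ K.faces, v ∈ s → s = {v}) :
    vertexClass hv {v} = 0 := by
  refine (RedCohomology.mk_eq_zero_iff _).mpr ⟨fun _ => 1, funext fun s => ?_⟩
  rw [coboundary_zero_apply (by norm_num)]
  have hc := s.2.2
  refine (if_pos ?_).symm
  rcases s.2.1 with h' | h'
  · simp [h'] at hc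
  · exact (Finset.Nonempty.subset_singleton_iff
      (Finset.card_pos.mp (by omega))).mp h'.2

/-- The vertex `j` of `K_I`. -/
def vertexSimplex (hK : ∀ j, {j} ∈ K.faces) {I : Finset V} {j : V} (hj : j ∈ I) :
    Simplex (fullSubcomplex K I) 0 :=
  ⟨{j}, Or.inr ⟨hK j, Finset.singleton_subset_iff.mpr hj⟩, by simp⟩

/-- Coboundaries in degree 0 are constant, while this cocycle is `c` at `v` and 0 at `j`. -/
theorem smul_vertexClass_eq_zero (hK : ∀ j, {j} ∈ K.faces)
    (hv : ∀ s ∈ K.faces, v ∈ s → s = {v}) {I : Finset V} (h : v ∈ I) {j : V} (hj : j ∈ I)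
    (hjv : j ≠ v) {c : ℤ} (hc : c • vertexClass hv I = 0) : c = 0 := by
  rw [vertexClass, ← map_smul, RedCohomology.mk_eq_zero_iff] at hc
  obtain ⟨β, hβ⟩ := hc
  have h₁ := congrFun hβ (vertexSimplex hK h)
  have h₂ := congrFun hβ (vertexSimplex hK hj)
  rw [coboundary_zero_apply (by norm_num)] at h₁ h₂
  simp [vertexSimplex, hjv] at h₁ h₂
  omega

theorem exists_eq_smul_vertexClass (hv : ∀ s ∈ K.faces, v ∈ s → s = {v}) {I : Finset V}
    (x : RedCohomology (fullSubcomplex K I) 0)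
    (hx : RedCohomology.map (fullSubcomplex_mono K (I.erase_subset v)) 0 x = 0) :
    ∃ c : ℤ, x = c • vertexClass hv I := by
  obtain ⟨α, rfl⟩ := RedCohomology.mk_surjective x
  rw [RedCohomology.map_mk, RedCohomology.mk_eq_zero_iff] at hx
  obtain ⟨β, hβ⟩ := hx
  set b := β (emptySimplex _ (by norm_num)) with hb
  have key : ∀ s : Simplex (fullSubcomplex K I) 0, v ∉ s.1 → α.1 s = b := by
    intro s hs
    have := congrFun hβ
      ⟨s.1, s.2.1.imp id fun h' => ⟨h'.1, Finset.subset_erase.mpr ⟨h'.2, hs⟩⟩, s.2.2⟩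
    rw [coboundary_zero_apply (by norm_num)] at this
    exact this.symm
  by_cases h : ∃ s : Simplex (fullSubcomplex K I) 0, s.1 = {v}
  · obtain ⟨s₀, hs₀⟩ := h
    -- Away from `v` the cocycle is the constant `b`, so subtracting this multiple of the indicator
    -- leaves `b` everywhere.
    refine ⟨α.1 s₀ - b, sub_eq_zero.mp ?_⟩
    rw [vertexClass, ← map_smul, ← map_sub, RedCohomology.mk_eq_zero_iff]
    refine ⟨fun _ => b, funext fun s => ?_⟩
    rw [coboundary_zero_apply (by norm_num)]
    by_cases hs : s.1 = {v}
    · obtain rfl : s = s₀ := Subtype.ext (hs.trans hs₀.symm)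
      simp [hs]
    · have hs' : v ∉ s.1 := fun hvs => by
        rcases s.2.1 with h' | h'
        · simp [h'] at hvs
        · exact hs (hv _ h'.1 hvs)
      simp [hs, key s hs']
  · refine ⟨0, ?_⟩
    rw [zero_smul, RedCohomology.mk_eq_zero_iff]
    refine ⟨fun _ => b, funext fun s => ?_⟩
    rw [coboundary_zero_apply (by norm_num), key]
    intro hvs
    rcases s.2.1 with h' | h'
    · simp [h'] at hvs
    · exact h ⟨s, hv _ h'.1 hvs⟩

/-- The coboundary of a (-1)-cochain at any vertex is its value on the empty simplex, so a cocycle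
vanishes. -/
theorem RedCohomology.neg_one_subsingleton (hK : ∀ j, {j} ∈ K.faces) {I : Finset V}
    (hI : I.Nonempty) : Subsingleton (RedCohomology (fullSubcomplex K I) (-1)) := by
  refine subsingleton_of_forall_eq 0 fun x => ?_
  obtain ⟨α, rfl⟩ := RedCohomology.mk_surjective x
  obtain ⟨j, hj⟩ := hI
  have h := congrFun (LinearMap.mem_ker.mp α.2) (vertexSimplex hK hj)
  rw [coboundary_zero_apply (by norm_num)] at h
  refine (RedCohomology.mk_eq_zero_iff _).mpr ⟨0, funext fun s => ?_⟩
  rw [eq_emptySimplex (by norm_num) s, h]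
  simp

/-- The generator of `H̃^{-1}(K_∅)`. -/
def emptyClass (K : PreAbstractSimplicialComplex V) : RedCohomology (fullSubcomplex K ∅) (-1) :=
  RedCohomology.mk ⟨fun _ => 1, by
    refine LinearMap.mem_ker.mpr (funext fun s => ?_)
    have hc := s.2.2
    rcases s.2.1 with h | h
    · simp [h] at hc
    · simp [Finset.subset_empty.mp h.2] at hc⟩

theorem exists_eq_smul_emptyClass (x : RedCohomology (fullSubcomplex K ∅) (-1)) :
    ∃ c : ℤ, x = c • emptyClass K := by
  obtain ⟨α, rfl⟩ := RedCohomology.mk_surjective x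
  refine ⟨α.1 (emptySimplex _ (by norm_num)), ?_⟩
  rw [emptyClass, ← map_smul]
  refine congrArg _ (Subtype.ext (funext fun s => ?_))
  rw [eq_emptySimplex (by norm_num) s]
  simp

theorem smul_emptyClass_eq_zero {c : ℤ} (hc : c • emptyClass K = 0) : c = 0 := by
  rw [emptyClass, ← map_smul, RedCohomology.mk_eq_zero_iff] at hc
  obtain ⟨β, hβ⟩ := hc
  have : IsEmpty (Simplex (fullSubcomplex K ∅) (-1 - 1)) :=
    ⟨fun s => by have := s.2.2; omega⟩
  have hβ0 : β = 0 := funext fun s => isEmptyElim s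
  have h := congrFun hβ (emptySimplex _ (by norm_num))
  rw [hβ0, map_zero] at h
  simpa using h.symm

end Isolated

end DoubleCohomology

namespace DoubleCohomology

/-! ### Signs and commuting restrictions. -/

section Signs

variable {V : Type*} [LinearOrder V] {K : PreAbstractSimplicialComplex V} {p : ℤ}

theorem negOnePow_mul_self (n : ℤ) : (n.negOnePow : ℤ) * (n.negOnePow : ℤ) = 1 := by
  rw [← Units.val_mul, ← Int.negOnePow_add, Int.negOnePow_even _ (Even.add_self n)]
  rfl

theorem eps_insert_of_lt {i j : V} {J : Finset V} (hi : i ∉ J) (hij : i < j) :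
    eps j (insert i J) = -eps j J := by
  rw [eps, eps, Finset.filter_insert, if_pos hij, Finset.card_insert_of_notMem, pow_succ]
  · ring
  · simp [hi]

theorem eps_insert_of_le {i j : V} {J : Finset V} (hij : j ≤ i) :
    eps j (insert i J) = eps j J := by
  rw [eps, eps, Finset.filter_insert, if_neg hij.not_gt]

theorem eps_mul_eps_insert {i j : V} {J : Finset V} (hij : i ≠ j) (hi : i ∉ J) (hj : j ∉ J) :
    eps i (insert i J) * eps j (insert j (insert i J)) =
      -(eps j (insert j J) * eps i (insert i (insert j J))) := by
  simp only [eps_insert_of_le le_rfl]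
  rcases hij.lt_or_gt with h | h
  · rw [eps_insert_of_lt hi h, eps_insert_of_le h.le]
    ring
  · rw [eps_insert_of_lt hj h, eps_insert_of_le h.le]
    ring

/-- The types of `x I` and `x I'` depend on the index; restricting to a common `J` makes them
comparable. -/
theorem map_congr_index (x : HochsterSum K p) {I I' J : Finset V} (hI : I = I') (h : J ⊆ I)
    (h' : J ⊆ I') :
    RedCohomology.map (fullSubcomplex_mono K h) p (x I) =
      RedCohomology.map (fullSubcomplex_mono K h') p (x I') := by
  subst hI
  rfl

theorem psi_psi_comm (x : HochsterSum K p) (i j : V) (J : Finset V) :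
    psi K p i J (psi K p j (insert i J) (x (insert j (insert i J)))) =
      psi K p j J (psi K p i (insert j J) (x (insert i (insert j J)))) := by
  rw [psi, psi, psi, psi, RedCohomology.map_map, RedCohomology.map_map]
  exact map_congr_index x (Finset.insert_comm j i J)
    ((Finset.subset_insert i J).trans (Finset.subset_insert _ _))
    ((Finset.subset_insert j J).trans (Finset.subset_insert _ _))

end Signs

/-! ### The differential `d'` and a contraction along one vertex. -/

section Differential

variable {V : Type*} [LinearOrder V] [Fintype V] {K : PreAbstractSimplicialComplex V} {p l : ℤ}

theorem dPrime_apply (x : HochsterSum K p) (J : Finset V) :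
    dPrime K p x J = ((p + 1).negOnePow : ℤ) •
      ∑ i ∈ Jᶜ, eps i (insert i J) • psi K p i J (x (insert i J)) := by
  simp [dPrime]

theorem dPrime_apply_eq_single (x : HochsterSum K p) {J : Finset V} {w : V} (hw : w ∉ J)
    (h : ∀ i, i ∉ J → i ≠ w → psi K p i J (x (insert i J)) = 0) :
    dPrime K p x J =
      (((p + 1).negOnePow : ℤ) * eps w (insert w J)) • psi K p w J (x (insert w J)) := by
  rw [dPrime_apply, Finset.sum_eq_single_of_mem w (Finset.mem_compl.mpr hw), mul_smul]
  intro i hi hiw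
  rw [h i (Finset.mem_compl.mp hi) hiw, smul_zero]

/-- Removing `i` then `j` cancels against removing `j` then `i`: the restrictions agree and the
signs are opposite. -/
theorem dPrime_dPrime (x : HochsterSum K p) : dPrime K p (dPrime K p x) = 0 := by
  funext J
  rw [dPrime_apply]
  simp only [dPrime_apply, map_smul, map_sum, Finset.smul_sum, smul_smul]
  rw [Finset.sum_sigma']
  refine Finset.sum_involution (fun a _ => ⟨a.2, a.1⟩) ?_ ?_ ?_ ?_
  · rintro ⟨i, j⟩ h
    simp only [Finset.mem_sigma, Finset.mem_compl, Finset.mem_insert, not_or] at h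
    obtain ⟨hi, hji, hj⟩ := h
    dsimp only
    rw [psi_psi_comm x i j J, ← add_smul]
    have := eps_mul_eps_insert (Ne.symm hji) hi hj
    generalize ((p + 1).negOnePow : ℤ) = u
    convert zero_smul ℤ _ using 2
    linear_combination u * u * this
  · rintro ⟨i, j⟩ h _ he
    simp only [Finset.mem_sigma, Finset.mem_compl, Finset.mem_insert, not_or] at h
    simp only [Sigma.mk.injEq] at he
    exact h.2.1 he.1
  · rintro ⟨i, j⟩ h
    simp only [Finset.mem_sigma, Finset.mem_compl, Finset.mem_insert, not_or] at h ⊢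
    exact ⟨h.2.2, Ne.symm h.2.1, h.1⟩
  · rintro ⟨i, j⟩ _
    rfl

theorem dPrime_mem_CH {x : HochsterSum K p} (hx : x ∈ CH K p (l + 1)) :
    dPrime K p x ∈ CH K p l := by
  intro J hJ
  rw [dPrime_apply, Finset.sum_eq_zero, smul_zero]
  intro i hi
  rw [hx, map_zero, smul_zero]
  rw [Finset.card_insert_of_notMem (Finset.mem_compl.mp hi)]
  push_cast
  omega

theorem dPrime_mem_doubleCoboundaries {x : HochsterSum K p} (hx : x ∈ CH K p (l + 1)) :
    dPrime K p x ∈ doubleCoboundaries K p l :=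
  Submodule.mem_map_of_mem hx

/-- Components `x_J` with `w ∉ J` that lift along `ψ_w` are those of a coboundary. -/
theorem exists_dPrime_eq_of_lifts {x : HochsterSum K p} (hx : x ∈ CH K p l) (w : V)
    (Q : ∀ I, Submodule ℤ (RedCohomology (fullSubcomplex K I) p))
    (h : ∀ I, w ∈ I → ∃ z ∈ Q I,
      RedCohomology.map (fullSubcomplex_mono K (I.erase_subset w)) p z = x (I.erase w)) :
    ∃ y ∈ CH K p (l + 1), (∀ I, y I ∈ Q I) ∧ ∀ J, w ∉ J → dPrime K p y J = x J := by
  -- The lift is multiplied by the sign it meets in `d'`, which is its own inverse. It is set to 0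
  -- when `w ∉ I`, and when `I` has the wrong size, where the target vanishes as well.
  have h' : ∀ I, ∃ z ∈ Q I, ((I.card : ℤ) ≠ l + 1 → z = 0) ∧ (w ∉ I → z = 0) ∧
      (w ∈ I → RedCohomology.map (fullSubcomplex_mono K (I.erase_subset w)) p z =
        (((p + 1).negOnePow : ℤ) * eps w I) • x (I.erase w)) := by
    intro I
    by_cases hw : w ∈ I
    · by_cases hI : (I.card : ℤ) = l + 1
      · obtain ⟨z, hz, hzx⟩ := h I hw
        exact ⟨(((p + 1).negOnePow : ℤ) * eps w I) • z, Submodule.smul_mem _ _ hz,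
          fun h => absurd hI h, fun h => absurd hw h, fun _ => by rw [map_smul, hzx]⟩
      · refine ⟨0, zero_mem _, fun _ => rfl, fun _ => rfl, fun _ => ?_⟩
        have := Finset.card_erase_add_one hw
        rw [hx, map_zero, smul_zero]
        omega
    · exact ⟨0, zero_mem _, fun _ => rfl, fun _ => rfl, fun h => absurd h hw⟩
  choose y hyQ hyc hy0 hy using h'
  refine ⟨y, hyc, hyQ, fun J hJ => ?_⟩
  rw [dPrime_apply_eq_single y hJ]
  · have h₁ : psi K p w J (y (insert w J)) =
        (((p + 1).negOnePow : ℤ) * eps w (insert w J)) • x J := by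
      have key : ∀ J' (hJ' : J' ⊆ insert w J), J' = (insert w J).erase w →
          RedCohomology.map (fullSubcomplex_mono K hJ') p (y (insert w J)) =
            (((p + 1).negOnePow : ℤ) * eps w (insert w J)) • x J' := by
        rintro _ _ rfl
        exact hy _ (Finset.mem_insert_self w J)
      exact key J (Finset.subset_insert w J) (Finset.erase_insert hJ).symm
    rw [h₁, smul_smul]
    have h₂ := negOnePow_mul_self (p + 1)
    have h₃ := eps_mul_self w (insert w J)
    generalize ((p + 1).negOnePow : ℤ) = u at *
    convert one_smul ℤ _ using 2
    linear_combination eps w (insert w J) * eps w (insert w J) * h₂ + h₃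
  -- For `i ≠ w` the set `insert i J` still misses `w`, where `y` is 0.
  · intro i _ hiw
    rw [hy0 _ (by simp [Ne.symm hiw, hJ]), map_zero]

end Differential

/-! ### Recognising the quotients 0 and ℤ. -/

section Quotients

variable {M : Type*} [AddCommGroup M]

theorem subsingleton_quotient_submoduleOf {A B : Submodule ℤ M} (h : A ≤ B) :
    Subsingleton (A ⧸ B.submoduleOf A) :=
  Submodule.Quotient.subsingleton_iff.mpr (Submodule.submoduleOf_eq_top.mpr h)

theorem nonempty_quotient_submoduleOf_addEquiv_int {A B : Submodule ℤ M} {e : M} (he : e ∈ A)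
    (hgen : ∀ x ∈ A, ∃ c : ℤ, x - c • e ∈ B) (hfree : ∀ c : ℤ, c • e ∈ B → c = 0) :
    Nonempty ((A ⧸ B.submoduleOf A) ≃+ ℤ) := by
  let f : ℤ →ₗ[ℤ] A ⧸ B.submoduleOf A :=
    LinearMap.toSpanSingleton ℤ _ (Submodule.Quotient.mk ⟨e, he⟩)
  have hf : ∀ c, f c = Submodule.Quotient.mk (c • ⟨e, he⟩) := fun c => rfl
  refine ⟨(LinearEquiv.ofBijective f ⟨?_, ?_⟩).symm.toAddEquiv⟩
  · refine (injective_iff_map_eq_zero f).mpr fun c hc => hfree c ?_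
    rw [hf, Submodule.Quotient.mk_eq_zero] at hc
    exact hc
  · intro x
    obtain ⟨⟨x, hx⟩, rfl⟩ := Submodule.Quotient.mk_surjective _ x
    obtain ⟨c, hc⟩ := hgen x hx
    refine ⟨c, ?_⟩
    rw [hf, eq_comm, Submodule.Quotient.eq]
    exact hc

end Quotients

end DoubleCohomology

namespace DoubleCohomology

/-! ### A functional that vanishes on coboundaries in degree 0. -/

section PairSum

variable {V : Type*} [LinearOrder V] {K : PreAbstractSimplicialComplex V}

/-- The difference of the values of a `0`-cocycle of `K_I` at two vertices. -/
def cocycleDifference (hK : ∀ j, {j} ∈ K.faces) {I : Finset V} {a b : V} (ha : a ∈ I)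
    (hb : b ∈ I) : cocycles (fullSubcomplex K I) 0 →ₗ[ℤ] ℤ where
  toFun α := α.1 (vertexSimplex hK hb) - α.1 (vertexSimplex hK ha)
  map_add' _ _ := add_sub_add_comm _ _ _ _
  map_smul' c _ := (mul_sub c _ _).symm

/-- The difference of the values of a class in `H̃^0(K_I)` at two vertices. -/
def difference (hK : ∀ j, {j} ∈ K.faces) {I : Finset V} {a b : V} (ha : a ∈ I) (hb : b ∈ I) :
    RedCohomology (fullSubcomplex K I) 0 →ₗ[ℤ] ℤ :=
  Submodule.liftQ _ (cocycleDifference hK ha hb) (by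
    rintro ⟨α, hα⟩ ⟨β, hβ⟩
    change coboundary _ (0 - 1) 0 _ β = α at hβ
    change α (vertexSimplex hK hb) - α (vertexSimplex hK ha) = 0
    rw [← hβ, coboundary_zero_apply (by norm_num), coboundary_zero_apply (by norm_num), sub_self])

theorem difference_mk (hK : ∀ j, {j} ∈ K.faces) {I : Finset V} {a b : V} (ha : a ∈ I)
    (hb : b ∈ I) (α : cocycles (fullSubcomplex K I) 0) :
    difference hK ha hb (RedCohomology.mk α) =
      α.1 (vertexSimplex hK hb) - α.1 (vertexSimplex hK ha) :=
  rfl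

theorem difference_vertexClass (hK : ∀ j, {j} ∈ K.faces) {v : V}
    (hv : ∀ s ∈ K.faces, v ∈ s → s = {v}) {I : Finset V} {a b : V} (ha : a ∈ I) (hb : b ∈ I) :
    difference hK ha hb (vertexClass hv I) =
      (if b = v then 1 else 0) - (if a = v then 1 else 0) := by
  rw [vertexClass, difference_mk]
  simp [vertexSimplex]

/-- The sign of `b - a`. -/
def orderSign (a b : V) : ℤ :=
  if a < b then 1 else if b < a then -1 else 0

theorem orderSign_swap (a b : V) : orderSign a b = -orderSign b a := by
  rcases lt_trichotomy a b with h | rfl | h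
  · simp [orderSign, h, h.not_gt]
  · simp [orderSign]
  · simp [orderSign, h, h.not_gt]

theorem orderSign_ne_zero {a b : V} (h : a ≠ b) : orderSign a b ≠ 0 := by
  rcases h.lt_or_gt with h | h
  · simp [orderSign, h]
  · simp [orderSign, h, h.not_gt]

theorem eps_insert_pair {a b i : V} (hab : a ≠ b) (hia : i ≠ a) (hib : i ≠ b) :
    eps i (insert i {a, b}) = orderSign i a * orderSign i b := by
  rw [eps_insert_of_le le_rfl, eps, Finset.filter_insert, Finset.filter_singleton]
  rcases hia.lt_or_gt with h | h <;> rcases hib.lt_or_gt with h' | h' <;>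
    simp [orderSign, h, h', h.not_gt, h'.not_gt, hab]

theorem sum_sum_eq_zero_of_antisymm {ι : Type*} [Fintype ι] {G : ι → ι → ℤ}
    (h : ∀ a b, G a b = -G b a) : ∑ a, ∑ b, G a b = 0 := by
  have h₁ : ∑ a, ∑ b, G a b = -∑ a, ∑ b, G a b := by
    conv_lhs => rw [Finset.sum_comm]
    simp only [← Finset.sum_neg_distrib]
    exact Finset.sum_congr rfl fun a _ => Finset.sum_congr rfl fun b _ => h b a
  omega

variable [Fintype V]

/-- The signed sum over all pairs of vertices `a`, `b` of the differences of the component in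
`H̃^0(K_{a, b})`. Each unordered pair is counted twice. -/
def pairSum (hK : ∀ j, {j} ∈ K.faces) : HochsterSum K 0 →ₗ[ℤ] ℤ :=
  ∑ a, ∑ b, orderSign a b •
    difference hK (Finset.mem_insert_self a {b})
      (Finset.mem_insert_of_mem (Finset.mem_singleton_self b)) ∘ₗ LinearMap.proj {a, b}

theorem pairSum_apply (hK : ∀ j, {j} ∈ K.faces) (x : HochsterSum K 0) :
    pairSum hK x = ∑ a, ∑ b, orderSign a b *
      difference hK (Finset.mem_insert_self a {b})
        (Finset.mem_insert_of_mem (Finset.mem_singleton_self b)) (x {a, b}) := by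
  simp [pairSum]

theorem pairSum_dPrime (hK : ∀ j, {j} ∈ K.faces) (y : HochsterSum K 0) :
    pairSum hK (dPrime K 0 y) = 0 := by
  choose α hα using fun I => RedCohomology.mk_surjective (y I)
  let g : Finset V → V → ℤ := fun I a =>
    if h : a ∈ I then (α I).1 (vertexSimplex hK h) else 0
  have hg : ∀ a b i, difference hK (Finset.mem_insert_self a {b})
      (Finset.mem_insert_of_mem (Finset.mem_singleton_self b))
      (psi K 0 i {a, b} (y (insert i {a, b}))) =
        g (insert i {a, b}) b - g (insert i {a, b}) a := by
    intro a b i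
    rw [← hα, psi, RedCohomology.map_mk, difference_mk]
    simp only [g]
    rw [dif_pos (by simp), dif_pos (by simp)]
    rfl
  have hterm : ∀ a b, orderSign a b *
      difference hK (Finset.mem_insert_self a {b})
        (Finset.mem_insert_of_mem (Finset.mem_singleton_self b)) (dPrime K 0 y {a, b}) =
      ((0 + 1 : ℤ).negOnePow : ℤ) * (∑ i, orderSign a b * orderSign i a * orderSign i b *
          g (insert i {a, b}) b -
        ∑ i, orderSign a b * orderSign i a * orderSign i b * g (insert i {a, b}) a) := by
    intro a b
    rcases eq_or_ne a b with rfl | hab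
    · simp [orderSign]
    rw [dPrime_apply, map_smul, smul_eq_mul, mul_left_comm, ← Finset.sum_sub_distrib, map_sum,
      Finset.mul_sum]
    congr 1
    -- Terms with `i ∈ {a, b}` carry a factor `orderSign i i = 0`, so `i` may range over all of `V`.
    rw [← Finset.sum_subset (Finset.subset_univ ({a, b} : Finset V)ᶜ)]
    · refine Finset.sum_congr rfl fun i hi => ?_
      simp only [Finset.mem_compl, Finset.mem_insert, Finset.mem_singleton, not_or] at hi
      rw [map_smul, hg, smul_eq_mul, eps_insert_pair hab hi.1 hi.2]
      ring
    · intro i _ hi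
      simp only [Finset.mem_compl, Finset.mem_insert, Finset.mem_singleton, not_not] at hi
      rcases hi with rfl | rfl <;> simp [orderSign]
  rw [pairSum_apply]
  simp only [hterm, ← Finset.mul_sum, Finset.sum_sub_distrib]
  rw [Finset.sum_comm, Finset.sum_eq_zero, Finset.sum_eq_zero, sub_self, mul_zero]
  -- With `a` fixed, exchanging `b` and `i` preserves the triple and the value at `a`, but reverses
  -- all three signs.
  · intro a _
    refine sum_sum_eq_zero_of_antisymm fun b i => ?_
    rw [show (insert i {a, b} : Finset V) = insert b {a, i} by ext; simp; tauto,
      orderSign_swap i a, orderSign_swap i b, orderSign_swap b a]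
    ring
  · intro b _
    refine sum_sum_eq_zero_of_antisymm fun a i => ?_
    rw [show (insert i {a, b} : Finset V) = insert a {i, b} by ext; simp; tauto,
      orderSign_swap i a]
    ring

end PairSum

/-! ### Double cohomology in degrees `p ≥ 0`. -/

section IsolatedVertex

variable {V : Type*} [LinearOrder V] [Fintype V] {K : PreAbstractSimplicialComplex V} {p l : ℤ}
  {v w : V}

/-- If `v ∈ I`, the component of `d' x` at `I \ {v}` has just one possibly nonzero term, up to sign
the restriction of `x I`: every other term comes from a set without `v`. -/
theorem map_erase_eq_zero_of_dPrime_eq_zero {x : HochsterSum K p} (hx : dPrime K p x = 0)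
    (h : ∀ J, v ∉ J → x J = 0) (I : Finset V) :
    RedCohomology.map (fullSubcomplex_mono K (I.erase_subset v)) p (x I) = 0 := by
  by_cases hv : v ∈ I
  · have h₁ := dPrime_apply_eq_single x (Finset.notMem_erase v I) fun i hi hiv => by
      rw [h _ (by simp [Ne.symm hiv]), map_zero]
    rw [hx] at h₁
    have h₂ : psi K p v (I.erase v) (x (insert v (I.erase v))) = 0 := by
      have h₃ := congrArg (fun z => (((p + 1).negOnePow : ℤ) *
        eps v (insert v (I.erase v))) • z) h₁.symm
      have h₄ := negOnePow_mul_self (p + 1)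
      have h₅ := eps_mul_self v (insert v (I.erase v))
      simp only [smul_smul, Pi.zero_apply, smul_zero] at h₃
      rw [mul_mul_mul_comm, h₄, h₅, one_mul, one_smul] at h₃
      exact h₃
    rw [psi, map_congr_index x (Finset.insert_erase hv) (Finset.subset_insert v _)
      (I.erase_subset v)] at h₂
    exact h₂
  · rw [h I hv, map_zero]

theorem exists_sub_dPrime_eq_zero_of_notMem (hv : ∀ s ∈ K.faces, v ∈ s → s = {v}) (hp : 0 ≤ p)
    {x : HochsterSum K p} (hx : x ∈ CH K p l) :
    ∃ y ∈ CH K p (l + 1), ∀ J, v ∉ J → (x - dPrime K p y) J = 0 := by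
  obtain ⟨y, hy, -, hyx⟩ := exists_dPrime_eq_of_lifts hx v (fun _ => ⊤) fun I _ => by
    obtain ⟨z, hz⟩ := map_erase_surjective hv I hp (x (I.erase v))
    exact ⟨z, trivial, hz⟩
  exact ⟨y, hy, fun J hJ => by rw [Pi.sub_apply, hyx J hJ, sub_self]⟩

theorem doubleCocycles_le_of_one_le (hv : ∀ s ∈ K.faces, v ∈ s → s = {v}) (hp : 1 ≤ p) :
    doubleCocycles K p l ≤ doubleCoboundaries K p l := by
  rintro x ⟨hx, hdx⟩
  obtain ⟨y, hy, h⟩ := exists_sub_dPrime_eq_zero_of_notMem hv (by omega) hx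
  have hd : dPrime K p (x - dPrime K p y) = 0 := by
    rw [map_sub, dPrime_dPrime, LinearMap.mem_ker.mp hdx, sub_zero]
  have h0 : x - dPrime K p y = 0 := funext fun I => map_erase_injective hv I hp
    ((map_erase_eq_zero_of_dPrime_eq_zero hd h I).trans (map_zero _).symm)
  rw [sub_eq_zero.mp h0]
  exact dPrime_mem_doubleCoboundaries hy

/-- The element of the Hochster sum whose only nonzero component is the class of the isolated
vertex `v` in `H̃^0(K_{v, w})`. -/
def pairClass (hv : ∀ s ∈ K.faces, v ∈ s → s = {v}) (w : V) : HochsterSum K 0 :=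
  fun I => if I = {v, w} then vertexClass hv I else 0

theorem pairClass_mem_doubleCocycles (hv : ∀ s ∈ K.faces, v ∈ s → s = {v}) (hw : w ≠ v) :
    pairClass hv w ∈ doubleCocycles K 0 2 := by
  refine ⟨fun I hI => if_neg ?_, LinearMap.mem_ker.mpr (funext fun J => ?_)⟩
  · rintro rfl
    exact hI (by rw [Finset.card_pair hw.symm]; norm_num)
  · rw [dPrime_apply, Finset.sum_eq_zero, smul_zero, Pi.zero_apply]
    intro i hi
    rw [pairClass]
    split_ifs with h
    · rw [psi, map_vertexClass hv (Finset.subset_insert i J)]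
      have hi' := Finset.mem_compl.mp hi
      by_cases hvJ : v ∈ J
      -- The only set containing `v` reached from `{v, w}` is `{v}`, where the class of `v`
      -- vanishes.
      · have hJ : J = {v} := by
          ext j
          have hj := Finset.ext_iff.mp h j
          have hiw := Finset.ext_iff.mp h i
          simp only [Finset.mem_insert, Finset.mem_singleton, true_or, true_iff] at hj hiw ⊢
          obtain rfl : i = w := hiw.resolve_left fun h => hi' (h ▸ hvJ)
          constructor
          · intro hjJ
            exact (hj.mp (Or.inr hjJ)).resolve_right fun h => hi' (h ▸ hjJ)
          · rintro rfl
            exact hvJ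
        rw [hJ, vertexClass_singleton, smul_zero]
      · rw [vertexClass_of_notMem hv hvJ, smul_zero]
    · rw [map_zero, smul_zero]

theorem smul_pairClass_mem_doubleCoboundaries (hK : ∀ j, {j} ∈ K.faces)
    (hv : ∀ s ∈ K.faces, v ∈ s → s = {v}) (hw : w ≠ v) {c : ℤ}
    (hc : c • pairClass hv w ∈ doubleCoboundaries K 0 l) : c = 0 := by
  obtain ⟨y, -, hy⟩ := hc
  have h := pairSum_dPrime hK y
  rw [hy, map_smul, smul_eq_mul] at h
  refine (mul_eq_zero.mp h).resolve_right ?_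
  -- Only the ordered pairs `(v, w)` and `(w, v)` contribute, each `-orderSign v w`, so `pairSum`
  -- takes the nonzero value `-2 * orderSign v w` on `pairClass`.
  have hterm : ∀ a b, orderSign a b * difference hK (Finset.mem_insert_self a {b})
      (Finset.mem_insert_of_mem (Finset.mem_singleton_self b)) (pairClass hv w {a, b}) =
      -orderSign v w * ((if a = v then if b = w then 1 else 0 else 0) +
        (if a = w then if b = v then 1 else 0 else 0)) := by
    intro a b
    by_cases hab : (a = v ∧ b = w) ∨ (a = w ∧ b = v)
    · rcases hab with ⟨rfl, rfl⟩ | ⟨rfl, rfl⟩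
      · rw [pairClass, if_pos rfl, difference_vertexClass]
        simp [hw, hw.symm]
      · rw [pairClass, if_pos (Finset.pair_comm _ _), difference_vertexClass,
          orderSign_swap]
        simp [hw]
    · have h₀ : orderSign a b = 0 ∨ pairClass hv w {a, b} = 0 := by
        rcases eq_or_ne a b with rfl | hne
        · exact Or.inl (by simp [orderSign])
        · refine Or.inr (if_neg fun heq => hab ?_)
          have ha : a ∈ ({v, w} : Finset V) := heq ▸ Finset.mem_insert_self a {b}
          have hb : b ∈ ({v, w} : Finset V) :=
            heq ▸ Finset.mem_insert_of_mem (Finset.mem_singleton_self b)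
          simp only [Finset.mem_insert, Finset.mem_singleton] at ha hb
          rcases ha with rfl | rfl <;> rcases hb with rfl | rfl <;> simp_all
      rw [not_or] at hab
      rw [← ite_and, ← ite_and, if_neg hab.1, if_neg hab.2, add_zero, mul_zero]
      rcases h₀ with h₀ | h₀
      · rw [h₀, zero_mul]
      · rw [h₀, map_zero, mul_zero]
  rw [pairSum_apply]
  simp only [hterm, ← Finset.mul_sum, Finset.sum_add_distrib]
  simp [orderSign_ne_zero hw.symm]

theorem exists_sub_smul_pairClass_mem (hK : ∀ j, {j} ∈ K.faces)
    (hv : ∀ s ∈ K.faces, v ∈ s → s = {v}) (hw : w ≠ v) {x : HochsterSum K 0}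
    (hx : x ∈ doubleCocycles K 0 l) :
    ∃ c : ℤ, c • pairClass hv w ∈ CH K 0 l ∧
      x - c • pairClass hv w ∈ doubleCoboundaries K 0 l := by
  obtain ⟨y, hy, h⟩ := exists_sub_dPrime_eq_zero_of_notMem hv le_rfl hx.1
  have hker : ∀ {x y}, dPrime K 0 x = 0 → dPrime K 0 (x - dPrime K 0 y) = 0 := fun {x y} hx => by
    rw [map_sub, dPrime_dPrime, hx, sub_zero]
  have hd := hker (y := y) (LinearMap.mem_ker.mp hx.2)
  have hCH : x - dPrime K 0 y ∈ CH K 0 l := sub_mem hx.1 (dPrime_mem_CH hy)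
  have hspan : ∀ I, ∃ c : ℤ, (x - dPrime K 0 y) I = c • vertexClass hv I := fun I =>
    exists_eq_smul_vertexClass hv _ (map_erase_eq_zero_of_dPrime_eq_zero hd h I)
  generalize hx' : x - dPrime K 0 y = x' at *
  -- Second contraction, now along `w`. Choosing lifts in the spans of the classes of `v` keeps
  -- every component a multiple of that class.
  obtain ⟨z, hz, hzQ, hzx⟩ := exists_dPrime_eq_of_lifts hCH w
    (fun I => Submodule.span ℤ {vertexClass hv I}) fun I _ => by
      obtain ⟨c, hc⟩ := hspan (I.erase w)
      exact ⟨c • vertexClass hv I, Submodule.smul_mem _ _ (Submodule.mem_span_singleton_self _),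
        by rw [map_smul, map_vertexClass hv (I.erase_subset w), hc]⟩
  have hd' := hker (y := z) hd
  have hw0 : ∀ J, w ∉ J → (x' - dPrime K 0 z) J = 0 := fun J hJ => by
    rw [Pi.sub_apply, hzx J hJ, sub_self]
  have hspan' : ∀ I, ∃ c : ℤ, c • vertexClass hv I = (x' - dPrime K 0 z) I := by
    intro I
    refine Submodule.mem_span_singleton.mp (Submodule.sub_mem _ ?_ ?_)
    · obtain ⟨c, hc⟩ := hspan I
      exact Submodule.mem_span_singleton.mpr ⟨c, hc.symm⟩
    · rw [dPrime_apply]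
      refine Submodule.smul_mem _ _ (Submodule.sum_mem _ fun i _ => Submodule.smul_mem _ _ ?_)
      obtain ⟨c, hc⟩ := Submodule.mem_span_singleton.mp (hzQ (insert i I))
      exact Submodule.mem_span_singleton.mpr ⟨c, by
        rw [← hc, map_smul, psi, map_vertexClass hv (Finset.subset_insert i I)]⟩
  have hzero : ∀ I, I ≠ {v, w} → (x' - dPrime K 0 z) I = 0 := by
    intro I hI
    by_cases hwI : w ∈ I
    · obtain ⟨c, hc⟩ := hspan' I
      by_cases hvI : v ∈ I
      · obtain ⟨j, hj, hjvw⟩ : ∃ j ∈ I, j ∉ ({v, w} : Finset V) := by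
          by_contra! hall
          exact hI (Finset.Subset.antisymm hall (by
            intro j hj
            rcases Finset.mem_insert.mp hj with rfl | hj
            · exact hvI
            · exact Finset.mem_singleton.mp hj ▸ hwI))
        simp only [Finset.mem_insert, Finset.mem_singleton, not_or] at hjvw
        -- The restriction to `I \ {w}` vanishes, yet there the class of `v` has infinite order,
        -- because `j` is a further vertex.
        have h0 := map_erase_eq_zero_of_dPrime_eq_zero hd' hw0 I
        rw [← hc, map_smul, map_vertexClass hv (I.erase_subset w)] at h0
        rw [← hc, smul_vertexClass_eq_zero hK hv (Finset.mem_erase.mpr ⟨hw.symm, hvI⟩)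
          (Finset.mem_erase.mpr ⟨hjvw.2, hj⟩) hjvw.1 h0, zero_smul]
      · rw [← hc, vertexClass_of_notMem hv hvI, smul_zero]
    · exact hw0 I hwI
  obtain ⟨c, hc⟩ := hspan' {v, w}
  have heq : x' - dPrime K 0 z = c • pairClass hv w := by
    funext I
    rw [Pi.smul_apply, pairClass]
    split_ifs with hI
    · subst hI
      exact hc.symm
    · rw [hzero I hI, smul_zero]
  refine ⟨c, heq ▸ sub_mem hCH (dPrime_mem_CH hz), ?_⟩
  rw [← heq, ← hx', show x - (x - dPrime K 0 y - dPrime K 0 z) =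
    dPrime K 0 y + dPrime K 0 z by abel]
  exact add_mem (dPrime_mem_doubleCoboundaries hy) (dPrime_mem_doubleCoboundaries hz)

theorem doubleCocycles_zero_le (hK : ∀ j, {j} ∈ K.faces)
    (hv : ∀ s ∈ K.faces, v ∈ s → s = {v}) (hw : w ≠ v) (hl : l ≠ 2) :
    doubleCocycles K 0 l ≤ doubleCoboundaries K 0 l := by
  intro x hx
  obtain ⟨c, hc, hxc⟩ := exists_sub_smul_pairClass_mem hK hv hw hx
  have h0 : c • pairClass hv w = 0 := by
    funext I
    by_cases hI : I = {v, w}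
    · refine hc I ?_
      rw [hI, Finset.card_pair hw.symm]
      exact fun h => hl (by simpa using h.symm)
    · rw [Pi.smul_apply, pairClass, if_neg hI, smul_zero]
      rfl
  rwa [h0, sub_zero] at hxc

end IsolatedVertex

/-! ### Double cohomology in degrees `p ≤ -1`. -/

section LowDegrees

variable {V : Type*} [LinearOrder V] [Fintype V] {K : PreAbstractSimplicialComplex V} {p l : ℤ}

theorem dPrime_neg_one (hK : ∀ j, {j} ∈ K.faces) : dPrime K (-1) = 0 := by
  refine LinearMap.ext fun x => funext fun J => ?_
  rw [dPrime_apply, Finset.sum_eq_zero, smul_zero]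
  · rfl
  intro i _
  have := RedCohomology.neg_one_subsingleton hK (Finset.insert_nonempty i J)
  rw [Subsingleton.elim (x (insert i J)) 0, map_zero, smul_zero]

theorem doubleCocycles_neg_one_le (hK : ∀ j, {j} ∈ K.faces) (hl : l ≠ 0) :
    doubleCocycles K (-1) l ≤ doubleCoboundaries K (-1) l := by
  rintro x ⟨hx, -⟩
  have h0 : x = 0 := by
    funext I
    rcases I.eq_empty_or_nonempty with rfl | hI
    · exact hx ∅ (by simpa using hl.symm)
    · have := RedCohomology.neg_one_subsingleton hK hI
      exact Subsingleton.elim _ _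
  rw [h0]
  exact zero_mem _

theorem doubleCocycles_le_of_lt (hp : p < -1) :
    doubleCocycles K p l ≤ doubleCoboundaries K p l := by
  intro x _
  have h0 : x = 0 := funext fun I =>
    (RedCohomology.subsingleton_of_lt hp).elim _ _
  rw [h0]
  exact zero_mem _

theorem nonempty_neg_one_addEquiv_int (hK : ∀ j, {j} ∈ K.faces) :
    Nonempty ((doubleCocycles K (-1) 0 ⧸
      (doubleCoboundaries K (-1) 0).submoduleOf (doubleCocycles K (-1) 0)) ≃+ ℤ) := by
  refine nonempty_quotient_submoduleOf_addEquiv_int (e := Pi.single ∅ (emptyClass K)) ?_ ?_ ?_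
  · refine ⟨fun I hI => Pi.single_eq_of_ne ?_ _, by rw [dPrime_neg_one hK]; rfl⟩
    rintro rfl
    exact hI (by simp)
  · intro x _
    obtain ⟨c, hc⟩ := exists_eq_smul_emptyClass (x ∅)
    refine ⟨c, ?_⟩
    suffices h : x - c • Pi.single ∅ (emptyClass K) = 0 from h ▸ zero_mem _
    funext I
    rcases I.eq_empty_or_nonempty with rfl | hI
    · simp [hc]
    · have := RedCohomology.neg_one_subsingleton hK hI
      exact Subsingleton.elim _ _
  · rintro c ⟨y, -, hy⟩
    rw [dPrime_neg_one hK] at hy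
    have h := congrFun hy ∅
    rw [Pi.smul_apply, Pi.single_eq_same] at h
    exact smul_emptyClass_eq_zero h.symm

end LowDegrees

end DoubleCohomology

open DoubleCohomology in
theorem theorem6p5 {V : Type*} [LinearOrder V] [Fintype V]
    (K : AbstractSimplicialComplex V) (K' : PreAbstractSimplicialComplex V) (v : V)
    (hK' : K'.faces.Nonempty)
    (hK : DoubleCohomology.IsDisjointUnion K.toPreAbstractSimplicialComplex K'
      (DoubleCohomology.point v)) :
    Nonempty (DoubleCohomology.HH K.toPreAbstractSimplicialComplex 0 0 ≃+ ℤ) ∧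
    Nonempty (DoubleCohomology.HH K.toPreAbstractSimplicialComplex 1 2 ≃+ ℤ) ∧
    ∀ k l : ℤ, (k, l) ≠ (0, 0) → (k, l) ≠ (1, 2) →
      Subsingleton (DoubleCohomology.HH K.toPreAbstractSimplicialComplex k l) := by
  have hvert : ∀ j, {j} ∈ K.faces := K.singleton_mem
  have hpt : {v} ∉ K'.faces := fun h => hK.2 v h rfl
  have hv : ∀ s ∈ K.faces, v ∈ s → s = {v} := by
    intro s hs hvs
    rw [hK.1] at hs
    rcases hs with hs | hs
    · exact absurd ((K'.isRelLowerSet_faces hs).2 (Finset.singleton_subset_iff.mpr hvs)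
        (Finset.singleton_nonempty v)) hpt
    · exact hs
  obtain ⟨w, hw⟩ : ∃ w, w ≠ v := by
    obtain ⟨s, hs⟩ := hK'
    obtain ⟨w, hws⟩ := (K'.isRelLowerSet_faces hs).1
    refine ⟨w, ?_⟩
    rintro rfl
    exact hpt ((K'.isRelLowerSet_faces hs).2 (Finset.singleton_subset_iff.mpr hws)
      (Finset.singleton_nonempty w))
  -- With `p = l - k - 1`, the pair (0, 0) means `p = -1` and (1, 2) means `p = 0`.
  refine ⟨nonempty_neg_one_addEquiv_int hvert,
    nonempty_quotient_submoduleOf_addEquiv_int (pairClass_mem_doubleCocycles hv hw)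
      (fun x hx => (exists_sub_smul_pairClass_mem hvert hv hw hx).imp fun _ h => h.2)
      fun c hc => smul_pairClass_mem_doubleCoboundaries hvert hv hw hc, fun k l h₀ h₁ => ?_⟩
  refine subsingleton_quotient_submoduleOf ?_
  obtain ⟨p, hp⟩ : ∃ p, p = l - k - 1 := ⟨_, rfl⟩
  rw [← hp]
  rcases lt_trichotomy p (-1) with h | rfl | h
  · exact doubleCocycles_le_of_lt h
  · exact doubleCocycles_neg_one_le hvert fun hl => h₀ (by ext <;> simp <;> omega)
  · rcases eq_or_ne p 0 with rfl | h'
    · exact doubleCocycles_zero_le hvert hv hw fun hl => h₁ (by ext <;> simp <;> omega)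
    · exact doubleCocycles_le_of_one_le hv (by omega)
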